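/- Let $a$ be an entire function on $\mathbb{C}$, let $c,d\in\mathbb{C}$ with $d\neq 0$, and let $P(z_1,z_2)$ be an entire function on $\mathbb{C}^2$ that is divisible by $(z_1-c)(z_2-d)$ in the ring of entire functions on $\mathbb{C}^2$, i.e. $P(z_1,z_2)=(z_1-c)(z_2-d)\,g(z_1,z_2)$ for some entire function $g$ on $\mathbb{C}^2$. Then every entire function $f$ on $\mathbb{C}$ satisfying $f'(z)+a(z)\,P(f(z),f'(z))=0$ for all $z\in\mathbb{C}$ is constant. Moreover, this assertion (for all such $a$, $c$, $d$, $P$, $f$) is equivalent to the Pólya–Saxer–Milloux theorem, in the sense that each implies the other: every entire function $f$ on $\mathbb{C}$ with $f(z)\neq 0$ and $f'(z)\neq 1$ for all $z\in\mathbb{C}$ is constant. -/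

import Mathlib

/-- Every entire solution `f` of `f' + a(z) P(f, f') = 0` is constant, whenever `a` is entire on `ℂ`,
`P` is entire on `ℂ²`, and `P` is divisible by `(z₁ - c) (z₂ - d)` in the ring of entire functions
on `ℂ²`, where `d ≠ 0`. -/
def EntireSolutionsConstant : Prop :=
  ∀ (a : ℂ → ℂ) (P : ℂ × ℂ → ℂ) (c d : ℂ),
    Differentiable ℂ a →
    Differentiable ℂ P →
    d ≠ 0 →
    (∃ g : ℂ × ℂ → ℂ, Differentiable ℂ g ∧
      ∀ w : ℂ × ℂ, P w = (w.1 - c) * (w.2 - d) * g w) →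
    ∀ f : ℂ → ℂ, Differentiable ℂ f →
      (∀ z : ℂ, deriv f z + a z * P (f z, deriv f z) = 0) →
      ∃ k : ℂ, ∀ z : ℂ, f z = k

/-- The Pólya–Saxer–Milloux theorem: an entire function that omits `0` and whose derivative
omits `1` is constant. -/
def PolyaSaxerMilloux : Prop :=
  ∀ f : ℂ → ℂ, Differentiable ℂ f →
    (∀ z : ℂ, f z ≠ 0) →
    (∀ z : ℂ, deriv f z ≠ 1) →
    ∃ k : ℂ, ∀ z : ℂ, f z = k

/-! Pólya–Saxer–Milloux is proved by a Nevanlinna-type argument. Write `f = exp g` and `f' - 1 = exp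
h`, so `g' exp g = 1 + exp h`. If `h' = 0` identically, `f` is affine without zeros, hence constant.
Otherwise eliminating `exp h` gives `h' exp (-g) = g' h' - g'' - g' ^ 2` (`deriv_mul_exp_neg_eq`).
If `|g| ≤ D` on a disc, then `h'` and the right side are polynomially bounded in `D` on a smaller
one, so `log |h'| + (Re g)⁻ ≤ O(log D)` there. Jensen bounds the mean of `log |h'|` below, hence the
mean of `(Re g)⁻` is `O(log D)`; Poisson and Borel–Carathéodory turn this into a bound for `|g|`.
Thus the maximum modulus is at most about the square root of its value at a slightly larger radius,
so it is bounded, and Liouville applies. -/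

/-- An entire solution of `f' = k f` with `k` entire is `f 0 * exp G`, where `G' = k`. -/
theorem exists_eq_mul_exp_of_deriv_eq_mul {f k : ℂ → ℂ} (hf : Differentiable ℂ f)
    (hk : Differentiable ℂ k) (h : ∀ z, deriv f z = k z * f z) :
    ∃ G : ℂ → ℂ, Differentiable ℂ G ∧ ∀ z, f z = f 0 * Complex.exp (G z) := by
  obtain ⟨G, hG0, hG⟩ := hk.isExactOn_univ.with_val_at 0 0
  have hG' (z : ℂ) : HasDerivAt G (k z) z := hG z (Set.mem_univ z)
  refine ⟨G, fun z ↦ (hG' z).differentiableAt, fun z ↦ ?_⟩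
  have key (w : ℂ) : HasDerivAt (fun z ↦ f z * Complex.exp (-G z)) 0 w := by
    have := (hf w).hasDerivAt.mul (hG' w).neg.cexp
    rw [h w] at this
    convert! this using 1
    ring
  have hc := is_const_of_deriv_eq_zero (𝕜 := ℂ) (fun w ↦ (key w).differentiableAt)
    (fun w ↦ (key w).deriv) z 0
  simp only [hG0, neg_zero, Complex.exp_zero, mul_one] at hc
  rw [← hc, mul_assoc, ← Complex.exp_add]
  simp

/-- A zero-free entire function has an entire logarithm. -/
theorem exists_entire_log {f : ℂ → ℂ} (hf : Differentiable ℂ f) (h0 : ∀ z, f z ≠ 0) :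
    ∃ g : ℂ → ℂ, Differentiable ℂ g ∧ ∀ z, f z = Complex.exp (g z) := by
  obtain ⟨G, hG, h⟩ := exists_eq_mul_exp_of_deriv_eq_mul (k := fun z ↦ deriv f z / f z) hf
    (hf.deriv.div hf h0) (fun z ↦ (div_mul_cancel₀ _ (h0 z)).symm)
  refine ⟨fun z ↦ Complex.log (f 0) + G z, hG.const_add _, fun z ↦ ?_⟩
  rw [Complex.exp_add, Complex.exp_log (h0 0), h z]

/-! ### Estimates on discs and circles -/

/-- Cauchy's estimate on a smaller concentric disc. -/
theorem norm_deriv_le_of_norm_le_closedBall {g : ℂ → ℂ} (hg : Differentiable ℂ g) {B r s R : ℝ}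
    (hs : 0 < s) (hR : r + s ≤ R) (hB : ∀ z, ‖z‖ ≤ R → ‖g z‖ ≤ B) {z : ℂ} (hz : ‖z‖ ≤ r) :
    ‖deriv g z‖ ≤ B / s := by
  refine Complex.norm_deriv_le_of_forall_mem_sphere_norm_le hs hg.diffContOnCl fun w hw ↦ hB w ?_
  have : ‖w - z‖ = s := by simpa [dist_eq_norm] using hw
  linarith [norm_le_norm_sub_add w z]

/-- The Borel–Carathéodory inequality on a smaller concentric disc. -/
theorem norm_le_of_re_le {g : ℂ → ℂ} (hg : Differentiable ℂ g) {M r t ρ R : ℝ} (hr : 0 < r)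
    (ht : 0 < t) (hM : 0 < M) (hρ : 0 ≤ ρ) (hR : R = ρ + r * t) (hR' : R ≤ 7 * r)
    (hre : ∀ z, ‖z‖ ≤ R → (g z).re ≤ M) {z : ℂ} (hz : ‖z‖ ≤ ρ) :
    ‖g z‖ ≤ 14 * (M + ‖g 0‖) / t := by
  have hrt : 0 < r * t := mul_pos hr ht
  have h1 := Complex.borelCaratheodory (R := R) hM hg.differentiableOn
    (fun w hw ↦ hre w (mem_ball_zero_iff.mp hw).le) (by linarith)
    (mem_ball_zero_iff.mpr (by linarith : ‖z‖ < R))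
  have h2 : r * t ≤ R - ‖z‖ := by linarith
  have h0 := norm_nonneg (g 0)
  calc ‖g z‖ ≤ (2 * M * ‖z‖ + ‖g 0‖ * (R + ‖z‖)) / (R - ‖z‖) := by rw [add_div]; exact h1
    _ ≤ (14 * (M + ‖g 0‖) * r) / (r * t) := by
        gcongr
        nlinarith [norm_nonneg z]
    _ = _ := by field_simp

open InnerProductSpace in
/-- Poisson's formula bounds `-Re g` in a disc by the circle average of its positive part. -/
theorem neg_re_le_circleAverage {g : ℂ → ℂ} (hg : Differentiable ℂ g) {ρ : ℝ} {w : ℂ}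
    (hw : ‖w‖ < ρ) :
    -(g w).re ≤ (ρ + ‖w‖) / (ρ - ‖w‖) *
      Real.circleAverage (fun z ↦ max (-(g z).re) 0) 0 ρ := by
  have hρ : 0 < ρ := (norm_nonneg w).trans_lt hw
  have hwb : w ∈ Metric.ball (0 : ℂ) ρ := mem_ball_zero_iff.mpr hw
  have hharm : HarmonicOnNhd (fun z ↦ (-g z).re) (Metric.closedBall 0 ρ) :=
    fun z _ ↦ (hg.neg.analyticAt z).harmonicAt_re
  have hP := hharm.circleAverage_re_herglotzRieszKernel_smul hwb
  have hcont : ContinuousOn (Complex.re ∘ herglotzRieszKernel 0 w) (Metric.sphere 0 |ρ|) :=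
    Complex.continuous_re.comp_continuousOn (continuousOn_herglotzRieszKernel_sphere hwb)
  have hgc := hg.continuous
  rw [← smul_eq_mul, ← Real.circleAverage_fun_smul, ← Complex.neg_re, ← hP]
  refine Real.circleAverage_mono ?_ ?_ fun z hz ↦ ?_
  · refine ContinuousOn.circleIntegrable' (hcont.smul ?_)
    fun_prop
  · refine ContinuousOn.circleIntegrable' ?_
    fun_prop
  · rw [abs_of_pos hρ] at hz
    have h1 := re_herglotzRieszKernel_le hz hwb
    have h2 := le_re_herglotzRieszKernel hz hwb
    rw [sub_zero w] at h1 h2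
    have h3 : 0 ≤ (ρ - ‖w‖) / (ρ + ‖w‖) := div_nonneg (by linarith) (by positivity)
    simp only [Pi.smul_apply', Function.comp_apply, smul_eq_mul, Complex.neg_re,
      herglotzRieszKernel_def, sub_zero] at h1 h2 ⊢
    exact (mul_le_mul_of_nonneg_left (le_max_left _ 0) (h3.trans h2)).trans
      (mul_le_mul_of_nonneg_right h1 (le_max_right _ _))

/-- The sub-mean value inequality for `log ‖p‖`, with `p` entire. -/
theorem log_norm_le_circleAverage {p : ℂ → ℂ} (hp : Differentiable ℂ p) (h0 : p 0 ≠ 0) {ρ : ℝ}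
    (hρ : 0 < ρ) : Real.log ‖p 0‖ ≤ Real.circleAverage (fun z ↦ Real.log ‖p z‖) 0 ρ := by
  have han : AnalyticOnNhd ℂ p (Metric.closedBall 0 |ρ|) := fun z _ ↦ hp.analyticAt z
  rw [han.circleAverage_log_norm hρ.ne' h0]
  -- Jensen's formula: each zero `u` contributes its multiplicity times `log (ρ / ‖u‖) ≥ 0`; at `u =
  -- 0` the default `0⁻¹ = 0` makes the term vanish.
  refine le_add_of_nonneg_left (finsum_nonneg fun u ↦ ?_)
  by_cases hu : u ∈ Metric.closedBall (0 : ℂ) |ρ|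
  · refine mul_nonneg (mod_cast MeromorphicOn.AnalyticOnNhd.divisor_nonneg han u) ?_
    rcases eq_or_ne u 0 with rfl | hu0
    · simp
    · apply Real.log_nonneg
      rw [mem_closedBall_zero_iff, abs_of_pos hρ] at hu
      rw [zero_sub, norm_neg, ← div_eq_mul_inv, one_le_div (norm_pos_iff.mpr hu0)]
      exact hu
  · simp [hu]

/-- If `u + log ‖p‖ ≤ L` off the zeros of the entire function `p`, then the circle average of `u`
is at most `L - log ‖p 0‖`. -/
theorem circleAverage_le_sub_log_norm {p : ℂ → ℂ} (hp : Differentiable ℂ p) (h0 : p 0 ≠ 0)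
    {u : ℂ → ℝ} (hu : Continuous u) {ρ L : ℝ} (hρ : 0 < ρ)
    (h : ∀ z, ‖z‖ = ρ → p z ≠ 0 → u z + Real.log ‖p z‖ ≤ L) :
    Real.circleAverage u 0 ρ ≤ L - Real.log ‖p 0‖ := by
  classical
  -- At zeros of `p` the default `log 0 = 0` could break the pointwise bound. Changing the value on
  -- this discrete set leaves the average unchanged.
  set φ : ℂ → ℝ := fun z ↦ if p z = 0 then L - u z else Real.log ‖p z‖ with hφ
  have han : AnalyticOnNhd ℂ p Set.univ := fun z _ ↦ hp.analyticAt z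
  have hcod : (fun z ↦ Real.log ‖p z‖) =ᶠ[Filter.codiscreteWithin (Metric.sphere 0 |ρ|)] φ := by
    have := Filter.codiscreteWithin_mono (Set.subset_univ (Metric.sphere (0 : ℂ) |ρ|))
      (han.preimage_zero_mem_codiscrete h0)
    filter_upwards [this] with z hz
    have hz' : p z ≠ 0 := by simpa using hz
    simp [hφ, hz']
  have hlog : CircleIntegrable (fun z ↦ Real.log ‖p z‖) 0 ρ :=
    MeromorphicOn.circleIntegrable_log_norm fun z _ ↦ (hp.analyticAt z).meromorphicAt
  have hφi : CircleIntegrable φ 0 ρ := hlog.congr_codiscreteWithin hcod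
  have hui : CircleIntegrable u 0 ρ := hu.continuousOn.circleIntegrable'
  have hsum : Real.circleAverage (fun z ↦ u z + φ z) 0 ρ ≤ L := by
    refine Real.circleAverage_mono_on_of_le_circle (hui.add hφi) fun z hz ↦ ?_
    rw [mem_sphere_zero_iff_norm, abs_of_pos hρ] at hz
    by_cases hz0 : p z = 0
    · simp [hφ, hz0]
    · simpa [hφ, hz0] using h z hz hz0
  rw [Real.circleAverage_fun_add hui hφi,
    ← Real.circleAverage_congr_codiscreteWithin hcod hρ.ne'] at hsum
  linarith [log_norm_le_circleAverage hp h0 hρ]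

/-! ### Growth iteration -/

/-- A positive function that is monotone and satisfies a square-root self-improvement inequality
with polynomial loss in the relative gap between radii is bounded. -/
theorem bounded_of_sqrt_growth {D : ℝ → ℝ} (hmono : Monotone D) (hD : ∀ r, 1 ≤ D r) {C : ℝ}
    (hC : 1 ≤ C)
    (h : ∀ r t : ℝ, 1 ≤ r → 0 < t → t ≤ 1 → D r ≤ C * √(D (r * (1 + 6 * t))) / t ^ 3) :
    ∃ B, ∀ r, 1 ≤ r → D r ≤ B := by
  set K : ℝ := C ^ 2 * 2 ^ 30 with hK
  have hK1 : 1 ≤ K := by rw [hK]; nlinarith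
  refine ⟨K * 64, fun R hR ↦ ?_⟩
  by_contra! hlt
  -- The radii increase from `R` towards `2 * R`. With `t = 2⁻ⁿ / 32` the enlarged radius stays
  -- below the next one, and squaring `1 / t ^ 3` gives the factor `2 ^ 30 * 64 ^ n`.
  set ρ : ℕ → ℝ := fun n ↦ R * (2 - (1 / 2) ^ n) with hρ
  have hpow (n : ℕ) : (0 : ℝ) < (1 / 2) ^ n ∧ ((1 : ℝ) / 2) ^ n ≤ 1 :=
    ⟨by positivity, pow_le_one₀ (by norm_num) (by norm_num)⟩
  have step (n : ℕ) : D (ρ n) ^ 2 ≤ K * 64 ^ n * D (ρ (n + 1)) := by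
    obtain ⟨hp0, hp1⟩ := hpow n
    set x : ℝ := (1 / 2) ^ n with hx
    have hx2 : (64 : ℝ) ^ n = (x ^ 6)⁻¹ := by
      rw [hx, ← pow_mul, mul_comm, pow_mul, ← inv_pow]; norm_num
    have h1 := h (ρ n) (x / 32) (by simp only [hρ]; nlinarith) (by positivity) (by linarith)
    have h2 : D (ρ n * (1 + 6 * (x / 32))) ≤ D (ρ (n + 1)) := by
      apply hmono
      simp only [hρ, pow_succ, ← hx]
      nlinarith [mul_pos (by linarith : 0 < R) hp0]
    have h3 : D (ρ n) ≤ C * √(D (ρ (n + 1))) / (x / 32) ^ 3 := h1.trans (by gcongr)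
    have h4 : 0 ≤ D (ρ n) := zero_le_one.trans (hD _)
    have h5 : 0 ≤ D (ρ (n + 1)) := zero_le_one.trans (hD _)
    calc D (ρ n) ^ 2 ≤ (C * √(D (ρ (n + 1))) / (x / 32) ^ 3) ^ 2 := by gcongr
      _ = K * 64 ^ n * D (ρ (n + 1)) := by
        rw [div_pow, mul_pow, Real.sq_sqrt h5, hx2, hK]
        field_simp
        norm_num
  -- This lower bound reproduces itself exactly under `step`, and it contradicts the fixed bound `D
  -- (2 * R)`.
  have grow (n : ℕ) : K * 64 ^ (n + 1) ≤ D (ρ n) := by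
    induction n with
    | zero => simpa [hρ, show R * (2 - 1) = R by ring] using hlt.le
    | succ n ih =>
      have hpos : 0 < K * 64 ^ n := by positivity
      have h1 : (K * 64 ^ (n + 1)) ^ 2 ≤ D (ρ n) ^ 2 := by gcongr
      have h2 : K * 64 ^ n * (K * 64 ^ (n + 1 + 1)) ≤ K * 64 ^ n * D (ρ (n + 1)) :=
        le_trans (le_of_eq (by ring)) (h1.trans (step n))
      exact le_of_mul_le_mul_left h2 hpos
  obtain ⟨n, hn⟩ := pow_unbounded_of_one_lt (D (2 * R)) (by norm_num : (1 : ℝ) < 64)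
  have h1 : D (ρ n) ≤ D (2 * R) := hmono (by simp only [hρ]; nlinarith [(hpow n).1])
  have h2 : (64 : ℝ) ^ n ≤ K * 64 ^ (n + 1) := by
    rw [pow_succ]; nlinarith [pow_pos (by norm_num : (0 : ℝ) < 64) n]
  linarith [grow n]

/-! ### The equation `g' exp g = 1 + exp h` -/

/-- Differentiating `g' exp g = 1 + exp h` and eliminating `exp h`. -/
theorem deriv_mul_exp_neg_eq {g h : ℂ → ℂ} (hg : Differentiable ℂ g) (hh : Differentiable ℂ h)
    (heq : ∀ z, deriv g z * Complex.exp (g z) = 1 + Complex.exp (h z)) (z : ℂ) :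
    deriv h z * Complex.exp (-g z) =
      deriv g z * deriv h z - deriv (deriv g) z - deriv g z ^ 2 := by
  have h1 : HasDerivAt (fun z ↦ deriv g z * Complex.exp (g z))
      (deriv (deriv g) z * Complex.exp (g z) +
        deriv g z * (Complex.exp (g z) * deriv g z)) z :=
    (hg.deriv z).hasDerivAt.mul (hg z).hasDerivAt.cexp
  have h2 : HasDerivAt (fun z ↦ 1 + Complex.exp (h z)) (Complex.exp (h z) * deriv h z) z :=
    (hh z).hasDerivAt.cexp.const_add 1
  have h3 := h1.unique (by rw [funext heq]; exact h2)
  have h4 : Complex.exp (h z) = deriv g z * Complex.exp (g z) - 1 := by rw [heq z]; ring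
  have hne := Complex.exp_ne_zero (g z)
  rw [h4] at h3
  rw [Complex.exp_neg]
  field_simp
  linear_combination h3

/-- If `g' exp g = 1 + exp h`, a bound for `g` on a disc controls `h'` and
`g' h' - g'' - g' ^ 2` on a smaller one. -/
theorem norm_deriv_le_of_deriv_mul_exp_eq {g h : ℂ → ℂ} (hg : Differentiable ℂ g)
    (hh : Differentiable ℂ h)
    (heq : ∀ z, deriv g z * Complex.exp (g z) = 1 + Complex.exp (h z))
    {r t D : ℝ} (hr : 1 ≤ r) (ht : 0 < t) (ht1 : t ≤ 1) (hD : 1 ≤ D)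
    (hgD : ∀ z, ‖z‖ ≤ r * (1 + 6 * t) → ‖g z‖ ≤ D) {z : ℂ} (hz : ‖z‖ ≤ r * (1 + 3 * t)) :
    ‖deriv h z‖ ≤ (44 + 14 * ‖h 0‖) * D ^ 2 / t ^ 4 ∧
      ‖deriv g z * deriv h z - deriv (deriv g) z - deriv g z ^ 2‖ ≤
        (44 + 14 * ‖h 0‖) * D ^ 2 / t ^ 4 := by
  have hrt : 0 < r * t := by positivity
  -- Each estimate below costs one `r * t` of radius; `r ≥ 1` lets its bound be stated in `t` alone.
  have hle {x y : ℝ} (hx : 0 ≤ x) (hxy : y ≤ x / (r * t)) : y ≤ x / t :=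
    hxy.trans (by gcongr; nlinarith)
  have hg1 (w : ℂ) (hw : ‖w‖ ≤ r * (1 + 5 * t)) : ‖deriv g w‖ ≤ D / t :=
    hle (by linarith) (norm_deriv_le_of_norm_le_closedBall hg hrt (by linarith) hgD hw)
  have hg2 (w : ℂ) (hw : ‖w‖ ≤ r * (1 + 4 * t)) : ‖deriv (deriv g) w‖ ≤ D / t / t :=
    hle (by positivity)
      (norm_deriv_le_of_norm_le_closedBall hg.deriv hrt (by linarith) hg1 hw)
  have hre (w : ℂ) (hw : ‖w‖ ≤ r * (1 + 5 * t)) : (h w).re ≤ 2 * D / t := by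
    have h1 : ‖Complex.exp (h w)‖ ≤ ‖deriv g w‖ * Real.exp ‖g w‖ + 1 := by
      have : Complex.exp (h w) = deriv g w * Complex.exp (g w) - 1 := by rw [heq w]; ring
      rw [this]
      refine (norm_sub_le _ _).trans ?_
      rw [norm_mul, norm_one]
      gcongr
      exact Complex.norm_exp_le_exp_norm _
    have h2 : ‖deriv g w‖ * Real.exp ‖g w‖ + 1 ≤ Real.exp (‖deriv g w‖ + ‖g w‖) := by
      rw [Real.exp_add]
      have h3 := Real.add_one_le_exp ‖deriv g w‖
      have h4 := Real.one_le_exp (norm_nonneg (g w))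
      nlinarith
    rw [Complex.norm_exp] at h1
    have h5 := Real.exp_le_exp.mp (h1.trans h2)
    have h6 : D ≤ D / t := by rw [le_div_iff₀ ht]; nlinarith
    have h7 := hgD w (hw.trans (by nlinarith))
    have h8 : 2 * D / t = D / t + D / t := by ring
    linarith [hg1 w hw]
  have hh0 (w : ℂ) (hw : ‖w‖ ≤ r * (1 + 4 * t)) :
      ‖h w‖ ≤ (28 + 14 * ‖h 0‖) * D / t ^ 2 := by
    refine (norm_le_of_re_le hh (r := r) (ρ := r * (1 + 4 * t)) (R := r * (1 + 5 * t))
      (by linarith) ht (by positivity) (by positivity) (by ring) (by nlinarith) hre hw).trans ?_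
    have h1 : ‖h 0‖ ≤ ‖h 0‖ * D / t := by
      rw [le_div_iff₀ ht]
      have := norm_nonneg (h 0)
      nlinarith [mul_le_mul_of_nonneg_left (ht1.trans hD) this]
    calc 14 * (2 * D / t + ‖h 0‖) / t ≤ 14 * (2 * D / t + ‖h 0‖ * D / t) / t := by gcongr
      _ = _ := by field_simp; ring
  have hh1 : ‖deriv h z‖ ≤ (28 + 14 * ‖h 0‖) * D / t ^ 2 / t :=
    hle (by positivity) (norm_deriv_le_of_norm_le_closedBall hh hrt (by linarith) hh0 hz)
  have hg1z := hg1 z (hz.trans (by nlinarith))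
  have hg2z := hg2 z (hz.trans (by nlinarith))
  have hDD : D ≤ D ^ 2 := by nlinarith
  have ht43 : t ^ 4 ≤ t ^ 3 := pow_le_pow_of_le_one ht.le ht1 (by norm_num)
  have ht42 : t ^ 4 ≤ t ^ 2 := pow_le_pow_of_le_one ht.le ht1 (by norm_num)
  constructor
  · calc ‖deriv h z‖ ≤ (28 + 14 * ‖h 0‖) * D / t ^ 3 := hh1.trans (le_of_eq (by field_simp))
      _ ≤ (44 + 14 * ‖h 0‖) * D ^ 2 / t ^ 4 := by
        apply div_le_div₀ (by positivity) _ (by positivity) ht43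
        gcongr
        norm_num
  · calc _ ≤ ‖deriv g z‖ * ‖deriv h z‖ + ‖deriv (deriv g) z‖ + ‖deriv g z‖ ^ 2 := by
          refine (norm_sub_le _ _).trans (add_le_add ((norm_sub_le _ _).trans ?_) ?_)
          · rw [norm_mul]
          · rw [norm_pow]
      _ ≤ D / t * ((28 + 14 * ‖h 0‖) * D / t ^ 2 / t) + D / t / t + (D / t) ^ 2 := by gcongr
      _ = (28 + 14 * ‖h 0‖) * D ^ 2 / t ^ 4 + D / t ^ 2 + D ^ 2 / t ^ 2 := by field_simp
      _ ≤ (28 + 14 * ‖h 0‖) * D ^ 2 / t ^ 4 + D ^ 2 / t ^ 4 + D ^ 2 / t ^ 4 := by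
          refine add_le_add (add_le_add le_rfl ?_) ?_
          · exact div_le_div₀ (by positivity) hDD (by positivity) ht42
          · exact div_le_div_of_nonneg_left (by positivity) (by positivity) ht42
      _ = (30 + 14 * ‖h 0‖) * D ^ 2 / t ^ 4 := by ring
      _ ≤ _ := by gcongr; norm_num

/-- If `g' exp g = 1 + exp h` and `h' 0 ≠ 0`, the maximum modulus of `g` is bounded by a multiple
of the square root of its value at a slightly larger radius. -/
theorem exists_norm_le_sqrt_of_deriv_mul_exp_eq {g h : ℂ → ℂ} (hg : Differentiable ℂ g)
    (hh : Differentiable ℂ h)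
    (heq : ∀ z, deriv g z * Complex.exp (g z) = 1 + Complex.exp (h z)) (h0 : deriv h 0 ≠ 0) :
    ∃ C : ℝ, 1 ≤ C ∧ ∀ r t D : ℝ, 1 ≤ r → 0 < t → t ≤ 1 → 1 ≤ D →
      (∀ z, ‖z‖ ≤ r * (1 + 6 * t) → ‖g z‖ ≤ D) → ∀ z, ‖z‖ ≤ r → ‖g z‖ ≤ C * √D / t ^ 3 := by
  set H : ℝ := 44 + 14 * ‖h 0‖ with hH
  have hHpos : 44 ≤ H := by rw [hH]; linarith [norm_nonneg (h 0)]
  set A : ℝ := Real.log H + |Real.log ‖deriv h 0‖| + 8 with hA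
  have hA8 : 8 ≤ A := by
    rw [hA]; linarith [Real.log_nonneg (by linarith : 1 ≤ H), abs_nonneg (Real.log ‖deriv h 0‖)]
  refine ⟨14 * (7 * A + ‖g 0‖), by linarith [norm_nonneg (g 0)],
    fun r t D hr ht ht1 hD hgD ↦ ?_⟩
  have hrt : 0 < r * t := by positivity
  set X : ℝ := H * D ^ 2 / t ^ 4 with hX
  have hXpos : 0 < X := by positivity
  have hX1 : 1 ≤ X := by
    rw [hX, le_div_iff₀ (by positivity)]
    have : t ^ 4 ≤ 1 := pow_le_one₀ ht.le ht1
    nlinarith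
  have hρ : 0 < r * (1 + 3 * t) := by positivity
  have hmean := circleAverage_le_sub_log_norm hh.deriv h0
    (u := fun z ↦ max (-(g z).re) 0) (L := Real.log X)
    (by have := hg.continuous; fun_prop) hρ fun z hz hz0 ↦ by
      obtain ⟨b1, b2⟩ := norm_deriv_le_of_deriv_mul_exp_eq hg hh heq hr ht ht1 hD hgD hz.le
      have hpos : 0 < ‖deriv h z‖ := norm_pos_iff.mpr hz0
      rw [← deriv_mul_exp_neg_eq hg hh heq, norm_mul, Complex.norm_exp] at b2
      have c2 := Real.log_le_log (by positivity) b2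
      rw [Real.log_mul hpos.ne' (Real.exp_ne_zero _), Real.log_exp, Complex.neg_re] at c2
      have c1 := Real.log_le_log hpos b1
      rcases max_cases (-(g z).re) 0 with ⟨h1, _⟩ | ⟨h1, _⟩ <;> rw [h1] <;> linarith
  set m := Real.circleAverage (fun z ↦ max (-(g z).re) 0) 0 (r * (1 + 3 * t)) with hm
  have hsD : 1 ≤ √D := Real.one_le_sqrt.mpr hD
  have hlogX : Real.log X ≤ Real.log H + 4 * √D + 4 / t := by
    rw [hX, Real.log_div (by positivity) (by positivity), Real.log_mul (by positivity)
      (by positivity), Real.log_pow, Real.log_pow]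
    -- Any power of `D` below the first would do for the iteration.
    have e1 : Real.log D ≤ 2 * √D := by
      have := Real.log_le_self (Real.sqrt_nonneg D)
      rw [Real.log_sqrt (by linarith)] at this
      linarith
    have e2 : -Real.log t ≤ 1 / t := by
      rw [← Real.log_inv, one_div]
      exact Real.log_le_self (by positivity)
    have e3 : 4 / t = 4 * (1 / t) := by ring
    push_cast
    linarith
  have hmA : m ≤ A * √D / t := by
    have hk : m ≤ Real.log H + |Real.log ‖deriv h 0‖| + 4 * √D + 4 / t := by
      linarith [neg_abs_le (Real.log ‖deriv h 0‖)]
    refine hk.trans ?_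
    rw [le_div_iff₀ ht, add_mul, div_mul_cancel₀ _ ht.ne']
    have hE : 0 ≤ Real.log H + |Real.log ‖deriv h 0‖| := by linarith
    have : (Real.log H + |Real.log ‖deriv h 0‖|) * t ≤
        (Real.log H + |Real.log ‖deriv h 0‖|) * √D :=
      mul_le_mul_of_nonneg_left (by linarith) hE
    have h4 : 4 * √D * t ≤ 4 * √D := mul_le_of_le_one_right (by positivity) ht1
    rw [hA, add_mul]
    linarith
  have hm0 : 0 ≤ m := Real.circleAverage_nonneg_of_nonneg fun z _ ↦ le_max_right _ _
  have hM : 0 < 7 * A * √D / t ^ 2 := by positivity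
  have hre (w : ℂ) (hw : ‖w‖ ≤ r * (1 + 2 * t)) : (-g w).re ≤ 7 * A * √D / t ^ 2 := by
    have h1 := neg_re_le_circleAverage hg (ρ := r * (1 + 3 * t)) (w := w) (by linarith)
    rw [Complex.neg_re]
    calc _ ≤ _ := h1
      _ ≤ (7 * r) / (r * t) * (A * √D / t) := by
        gcongr
        · nlinarith
        · linarith
      _ = _ := by field_simp
  intro z hz
  have hBC := norm_le_of_re_le hg.neg (r := r) (by linarith) ht hM
    (ρ := r * (1 + t)) (by positivity) (by ring) (by nlinarith) hre
    (z := z) (hz.trans (by nlinarith))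
  rw [Pi.neg_apply, Pi.neg_apply, norm_neg, norm_neg] at hBC
  have h1 : ‖g 0‖ ≤ ‖g 0‖ * √D / t ^ 2 := by
    rw [le_div_iff₀ (by positivity)]
    have : t ^ 2 ≤ 1 := pow_le_one₀ ht.le ht1
    exact mul_le_mul_of_nonneg_left (this.trans hsD) (norm_nonneg _)
  calc ‖g z‖ ≤ _ := hBC
    _ ≤ 14 * (7 * A * √D / t ^ 2 + ‖g 0‖ * √D / t ^ 2) / t := by gcongr
    _ = _ := by field_simp

/-- Entire solutions of `g' exp g = 1 + exp h` with `h' 0 ≠ 0` have `g` constant. -/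
theorem eq_const_of_deriv_mul_exp_eq {g h : ℂ → ℂ} (hg : Differentiable ℂ g)
    (hh : Differentiable ℂ h)
    (heq : ∀ z, deriv g z * Complex.exp (g z) = 1 + Complex.exp (h z)) (h0 : deriv h 0 ≠ 0)
    (z w : ℂ) : g z = g w := by
  obtain ⟨C, hC, hstep⟩ := exists_norm_le_sqrt_of_deriv_mul_exp_eq hg hh heq h0
  have hbdd (r : ℝ) : BddAbove ((fun z ↦ ‖g z‖) '' Metric.closedBall 0 r) :=
    ((isCompact_closedBall (0 : ℂ) r).image hg.continuous.norm).bddAbove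
  set D : ℝ → ℝ := fun r ↦ max 1 (sSup ((fun z ↦ ‖g z‖) '' Metric.closedBall 0 r)) with hD
  have hle {r : ℝ} {z : ℂ} (hz : ‖z‖ ≤ r) : ‖g z‖ ≤ D r :=
    (le_csSup (hbdd r) ⟨z, mem_closedBall_zero_iff.mpr hz, rfl⟩).trans (le_max_right _ _)
  have hD1 (r : ℝ) : 1 ≤ D r := le_max_left _ _
  have hDle {r B : ℝ} (hB : 1 ≤ B) (h : ∀ z, ‖z‖ ≤ r → ‖g z‖ ≤ B) : D r ≤ B := by
    refine max_le hB (Real.sSup_le ?_ (by linarith))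
    rintro _ ⟨z, hz, rfl⟩
    exact h z (mem_closedBall_zero_iff.mp hz)
  obtain ⟨B, hB⟩ := bounded_of_sqrt_growth (D := D)
    (fun r s hrs ↦ hDle (hD1 s) fun z hz ↦ hle (hz.trans hrs)) hD1 hC
    (fun r t hr ht ht1 ↦ hDle
      (by
        rw [le_div_iff₀ (by positivity), one_mul]
        have h1 : t ^ 3 ≤ 1 := pow_le_one₀ ht.le ht1
        have h2 := Real.one_le_sqrt.mpr (hD1 (r * (1 + 6 * t)))
        nlinarith)
      (hstep r t _ hr ht ht1 (hD1 _) fun z hz ↦ hle hz))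
  refine hg.apply_eq_apply_of_bounded ((isBounded_iff_forall_norm_le).mpr ⟨B, ?_⟩) z w
  rintro _ ⟨x, rfl⟩
  exact (hle (le_max_right 1 ‖x‖)).trans (hB _ (le_max_left _ _))

/-! ### The theorem and the equivalence -/

/-- An entire function without zeros whose derivative is constant is constant. -/
theorem eq_const_of_deriv_const {f : ℂ → ℂ} (hf : Differentiable ℂ f) (h0 : ∀ z, f z ≠ 0)
    {b : ℂ} (hb : ∀ z, deriv f z = b) (z : ℂ) : f z = f 0 := by
  have haff (w : ℂ) : f w = f 0 + b * w := by
    have hd (x : ℂ) : HasDerivAt (fun x ↦ f x - b * x) 0 x := by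
      have := (hf x).hasDerivAt.sub ((hasDerivAt_id x).const_mul b)
      rw [hb x, mul_one, sub_self] at this
      exact this
    have := is_const_of_deriv_eq_zero (𝕜 := ℂ) (fun x ↦ (hd x).differentiableAt)
      (fun x ↦ (hd x).deriv) w 0
    simp only [mul_zero, sub_zero] at this
    linear_combination this
  rcases eq_or_ne b 0 with rfl | hb0
  · simpa using haff z
  · refine absurd ?_ (h0 (-f 0 / b))
    rw [haff]
    field_simp
    ring

/-- The Pólya–Saxer–Milloux theorem. -/
theorem polyaSaxerMilloux : PolyaSaxerMilloux := by
  intro f hf hf0 hf1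
  obtain ⟨g, hg, hfg⟩ := exists_entire_log hf hf0
  obtain ⟨h, hh, hfh⟩ := exists_entire_log (f := fun z ↦ deriv f z - 1) (hf.deriv.sub_const 1)
    (fun z ↦ sub_ne_zero.mpr (hf1 z))
  have hd (z : ℂ) : deriv f z = Complex.exp (g z) * deriv g z := by
    rw [funext hfg]
    exact (hg z).hasDerivAt.cexp.deriv
  have heq (z : ℂ) : deriv g z * Complex.exp (g z) = 1 + Complex.exp (h z) := by
    rw [← hfh z, hd z]
    ring
  by_cases hconst : ∀ z, deriv h z = 0
  · refine ⟨f 0, eq_const_of_deriv_const hf hf0 (b := 1 + Complex.exp (h 0)) fun z ↦ ?_⟩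
    rw [← is_const_of_deriv_eq_zero hh hconst z 0, ← hfh z]
    ring
  · push Not at hconst
    obtain ⟨a, ha⟩ := hconst
    -- Translation moves a point where `h' ≠ 0` to the centre, as Jensen's inequality needs.
    have key := eq_const_of_deriv_mul_exp_eq (g := fun z ↦ g (z + a)) (h := fun z ↦ h (z + a))
      (hg.comp (differentiable_id.add_const a)) (hh.comp (differentiable_id.add_const a))
      (fun z ↦ by rw [deriv_comp_add_const]; exact heq _)
      (by rw [deriv_comp_add_const, zero_add]; exact ha)
    refine ⟨f a, fun z ↦ ?_⟩
    rw [hfg, hfg a]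
    simpa using congrArg Complex.exp (key (z - a) 0)

/-- If `f` attains `c`, the equation is linear in `f - c` with entire coefficient, so `f - c` is a
constant times an exponential and vanishes identically. If `f` omits `c`, then `f'` omits `d`, since
`f' = d` kills `P` and leaves `d = 0`; rescale to `(f - c) / d`. -/
theorem PolyaSaxerMilloux.entireSolutionsConstant (hPSM : PolyaSaxerMilloux) :
    EntireSolutionsConstant := by
  rintro a P c d ha - hd ⟨g, hg, hP⟩ f hf heq
  by_cases hc : ∃ z, f z = c
  · obtain ⟨z₀, hz₀⟩ := hc
    have hk : Differentiable ℂ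
        fun z ↦ -a z * ((deriv f z - d) * g (f z, deriv f z)) :=
      ha.neg.mul ((hf.deriv.sub_const d).mul (hg.comp (hf.prodMk hf.deriv)))
    obtain ⟨G, -, hG⟩ := exists_eq_mul_exp_of_deriv_eq_mul (hf.sub_const c) hk fun z ↦ by
      have := heq z
      rw [hP] at this
      rw [deriv_sub_const]
      linear_combination this
    have h0 : f 0 - c = 0 := by
      have := hG z₀
      rw [hz₀, sub_self, eq_comm, mul_eq_zero] at this
      exact this.resolve_right (Complex.exp_ne_zero _)
    exact ⟨c, fun z ↦ sub_eq_zero.mp (by rw [hG z, h0, zero_mul])⟩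
  · push Not at hc
    obtain ⟨k, hk⟩ := hPSM (fun z ↦ (f z - c) / d) ((hf.sub_const c).div_const d)
      (fun z ↦ div_ne_zero (sub_ne_zero.mpr (hc z)) hd) fun z hz ↦ by
        rw [deriv_div_const, deriv_sub_const, div_eq_one_iff_eq hd] at hz
        have := heq z
        rw [hP, hz] at this
        exact hd (by simpa using this)
    refine ⟨k * d + c, fun z ↦ ?_⟩
    rw [← hk z, div_mul_cancel₀ _ hd, sub_add_cancel]

/-- Solve the equation for `a` with `P = z₁ (z₂ - 1)`: the two omitted values are what make the
quotient entire. -/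
theorem EntireSolutionsConstant.polyaSaxerMilloux (h : EntireSolutionsConstant) :
    PolyaSaxerMilloux := by
  intro f hf hf0 hf1
  have hf1' (z : ℂ) : deriv f z - 1 ≠ 0 := sub_ne_zero.mpr (hf1 z)
  refine h (fun z ↦ -deriv f z / (f z * (deriv f z - 1))) (fun w ↦ (w.1 - 0) * (w.2 - 1)) 0 1
    (hf.deriv.neg.div (hf.mul (hf.deriv.sub_const 1)) fun z ↦ mul_ne_zero (hf0 z) (hf1' z))
    (by fun_prop) one_ne_zero ⟨fun _ ↦ 1, by fun_prop, fun w ↦ (mul_one _).symm⟩ f hf fun z ↦ ?_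
  have h0 := hf0 z
  have h1 := hf1' z
  field_simp
  simp

theorem theorem1 :
    EntireSolutionsConstant ∧ (EntireSolutionsConstant ↔ PolyaSaxerMilloux) :=
  ⟨polyaSaxerMilloux.entireSolutionsConstant, EntireSolutionsConstant.polyaSaxerMilloux,
    PolyaSaxerMilloux.entireSolutionsConstant⟩
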